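/- **Setting ($k$-recharging bandits).** There are $n$ arms $1,\dots,n$ and an integer $k<n$. Arm $i$ has a payoff function $p_i:\{1,2,\dots\}\to[0,1]$, where $p_i(\tau)$ is the (mean) payoff for playing arm $i$ at delay $\tau$, i.e. exactly $\tau$ rounds after its previous play. Each $p_i$ is non-decreasing, and $p_i(\tau)=p_i(\tau^{\max})$ for all $\tau\ge\tau^{\max}$, where $\tau^{\max}\geq 1$ is a common upper bound on the recovery times. In each round $t=1,2,\dots$ at most $k$ arms are played, and the sum of their payoffs at their current delays is collected; all arms are regarded as played at time $0$ (so every delay is $1$ in round $1$). Let $\mathrm{OPT}(T)$ be the maximum total payoff that can be collected in rounds $1,\dots,T$, and let $\gamma_k=1-\frac{k^k}{e^k\,k!}$. **Algorithm ("Randomize-Then-Interleave") with payoff functions $q=(q_i)_i$.** 1. Compute an optimal extreme point solution $x^*$ of the linear program: maximize $\sum_i\sum_{\tau\ge1}q_i(\tau)x_{i,\tau}$ over $x\ge0$ subject to $\sum_i\sum_{\tau\ge1}x_{i,\tau}\le k$ and $\sum_{\tau\ge1}\tau x_{i,\tau}\le1$ for every $i$. 2. Independently for each arm $i$, draw a critical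 delay $\tau^*_i$, equal to $\tau$ with probability $\tau x^*_{i,\tau}$ and to $\infty$ with the remaining probability (so $\tau_i^*=\tau$ surely if $x^*_{i,\tau}=1/\tau$); arms with $\tau^*_i=\infty$ are discarded. For each remaining arm draw an offset $r_i$ uniformly from $\{0,1,\dots,\tau^*_i-1\}$. 3. In each round $t=1,2,\dots$ let $C_t$ be the set of remaining arms with $t \bmod \tau^*_i=r_i$, and play a set $A_t\subseteq C_t$ with $|A_t|\le k$ that maximizes $\sum_{i\in A_t}q_i(\sigma_{i,t})$, where $\sigma_{i,t}$ is the actual delay of arm $i$ in round $t$. Ties (both in the choice of $x^*$ and of $A_t$) are broken arbitrarily. The algorithm does not know the horizon $T$. **Lemma (robustness).** There is an absolute constant $C>0$ such that the following holds for every instance as above. Let $\epsilon\in(0,1)$ and let $\widehat p_i:\{1,2,\dots\}\to\mathbb R$ be estimates with $|\widehat p_i(\tau)-p_i(\tau)|\le\epsilon$ for every arm $i$ and every $\tau\ge1$. If the algorithm is run with $q=\widehat p$, then for every $T\ge 0$ its expected total payoff in $T$ rounds, measured with the true payoff functions $p_i$, is at least $$\gamma_k\,\mathrm{OPT}(T)-C\left(k\,\epsilon\,T+k\,\tau^{\max}\right).$$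 -/

import Mathlib

open MeasureTheory

noncomputable section

namespace RechargingBandits

variable {n : ℕ}

/-! ### Schedules and payoffs

Arms are the elements of `Fin n`, rounds are `t = 1, 2, 3, …`, and delays are positive integers.
A schedule `A` plays the set of arms `A t` in round `t`; the value `A 0` is irrelevant, since by
convention every arm has been played at time `0`. -/

/-- `delay A i t` is, for `t ≥ 1`, the number of rounds since arm `i` was last played before
round `t`, every arm being counted as played at time `0`; so all delays are `1` in round `1`.
(The value at `t = 0` is never used.) -/
def delay (A : ℕ → Finset (Fin n)) (i : Fin n) : ℕ → ℕ+
  | 0 => 1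
  | t + 1 => open Classical in if t = 0 ∨ i ∈ A t then 1 else delay A i t + 1

/-- The payoff, with respect to the payoff functions `p`, collected in rounds `1, …, T`. -/
def totalPayoff (p : Fin n → ℕ+ → ℝ) (A : ℕ → Finset (Fin n)) (T : ℕ) : ℝ :=
  ∑ t ∈ Finset.Icc 1 T, ∑ i ∈ A t, p i (delay A i t)

/-- `OPT(T)`: the maximum payoff that can be collected in `T` rounds when at most `k` arms are
played in each round. -/
def opt (p : Fin n → ℕ+ → ℝ) (k T : ℕ) : ℝ :=
  sSup {v : ℝ | ∃ A : ℕ → Finset (Fin n), (∀ t, (A t).card ≤ k) ∧ v = totalPayoff p A T}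

/-- `γ_k = 1 - k^k / (e^k k!)`. -/
def gammaK (k : ℕ) : ℝ := 1 - (k : ℝ) ^ k / (Real.exp 1 ^ k * (k.factorial : ℝ))

/-! ### The linear program -/

/-- Feasible solutions of the linear program: nonnegative `x` with
`∑_i ∑_τ x_{i,τ} ≤ k`, and `∑_τ τ x_{i,τ} ≤ 1` for every arm `i`. -/
def lpFeasible (n k : ℕ) : Set (Fin n → ℕ+ → ℝ) :=
  {x | (∀ i τ, 0 ≤ x i τ) ∧
    (∀ i, Summable fun τ : ℕ+ => x i τ) ∧
    ∑ i, ∑' τ : ℕ+, x i τ ≤ (k : ℝ) ∧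
    (∀ i, Summable fun τ : ℕ+ => ((τ : ℕ) : ℝ) * x i τ) ∧
    ∀ i, ∑' τ : ℕ+, ((τ : ℕ) : ℝ) * x i τ ≤ 1}

/-- The objective of the linear program for the payoff functions `q`. -/
def lpValue (q x : Fin n → ℕ+ → ℝ) : ℝ := ∑ i, ∑' τ : ℕ+, q i τ * x i τ

/-- `x` is an optimal extreme point solution of the linear program with objective given by `q`. -/
structure IsOptimalExtremePoint (q : Fin n → ℕ+ → ℝ) (k : ℕ) (x : Fin n → ℕ+ → ℝ) : Prop where
  extreme : x ∈ Set.extremePoints ℝ (lpFeasible n k)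
  optimal : ∀ y ∈ lpFeasible n k, lpValue q y ≤ lpValue q x

theorem IsOptimalExtremePoint.feasible {q x : Fin n → ℕ+ → ℝ} {k : ℕ}
    (h : IsOptimalExtremePoint q k x) : x ∈ lpFeasible n k :=
  extremePoints_subset h.extreme

/-! ### Initialization phase of "Randomize-Then-Interleave" -/

/-- The probability that the critical delay of arm `i` is `τ`, respectively `∞` (`none`). -/
def criticalMass (x : Fin n → ℕ+ → ℝ) (i : Fin n) : Option ℕ+ → ENNReal
  | some τ => ENNReal.ofReal (((τ : ℕ) : ℝ) * x i τ)
  | none => 1 - ∑' τ : ℕ+, ENNReal.ofReal (((τ : ℕ) : ℝ) * x i τ)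

theorem tsum_criticalMass {k : ℕ} {x : Fin n → ℕ+ → ℝ} (hx : x ∈ lpFeasible n k) (i : Fin n) :
    ∑' d, criticalMass x i d = 1 := by
  obtain ⟨h0, -, -, hs, h1⟩ := hx
  have hle : ∑' τ : ℕ+, ENNReal.ofReal (((τ : ℕ) : ℝ) * x i τ) ≤ 1 := by
    rw [← ENNReal.ofReal_tsum_of_nonneg
      (fun τ => mul_nonneg (Nat.cast_nonneg _) (h0 i τ)) (hs i)]
    exact ENNReal.ofReal_le_one.2 (h1 i)
  rw [ENNReal.tsum_eq_add_tsum_ite none, ← (Option.some_injective ℕ+).tsum_eq]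
  · simpa [criticalMass] using tsub_add_cancel_of_le hle
  · rintro (_ | τ) hd
    · simp at hd
    · exact ⟨τ, rfl⟩

/-- The law of the critical delay of arm `i`: it is `τ` with probability `τ x_{i,τ}`, and `∞`
(`none`; the arm is removed) with the remaining probability. For an arm with `x_{i,τ} = 1/τ` the
critical delay is `τ` (`criticalLaw_of_eq_inv`), an arm that is not supported is never used
(`criticalLaw_of_eq_zero`), and for the irregular arm this is the sampling step. -/
def criticalLaw {k : ℕ} (x : Fin n → ℕ+ → ℝ) (hx : x ∈ lpFeasible n k) (i : Fin n) :
    PMF (Option ℕ+) :=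
  ⟨criticalMass x i, tsum_criticalMass hx i ▸ ENNReal.summable.hasSum⟩

theorem eq_pure_of_apply_eq_one {α : Type*} (P : PMF α) (a : α) (h : P a = 1) : P = PMF.pure a := by
  classical
  have hs := (PMF.apply_eq_one_iff P a).1 h
  ext b
  by_cases hb : b = a
  · subst hb; simp [h]
  · have : b ∉ P.support := by rw [hs]; simpa using hb
    rw [PMF.mem_support_iff, not_not] at this
    simp [this, PMF.pure_apply, hb]

theorem criticalLaw_of_eq_inv {k : ℕ} (x : Fin n → ℕ+ → ℝ) (hx : x ∈ lpFeasible n k) (i : Fin n)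
    (τ : ℕ+) (h : x i τ = 1 / ((τ : ℕ) : ℝ)) : criticalLaw x hx i = PMF.pure (some τ) := by
  apply eq_pure_of_apply_eq_one
  change ENNReal.ofReal (((τ : ℕ) : ℝ) * x i τ) = 1
  have : ((τ : ℕ) : ℝ) ≠ 0 := by exact_mod_cast τ.ne_zero
  rw [h, mul_one_div_cancel this, ENNReal.ofReal_one]

theorem criticalLaw_of_eq_zero {k : ℕ} (x : Fin n → ℕ+ → ℝ) (hx : x ∈ lpFeasible n k) (i : Fin n)
    (h : ∀ τ, x i τ = 0) : criticalLaw x hx i = PMF.pure none := by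
  apply eq_pure_of_apply_eq_one
  change 1 - ∑' τ : ℕ+, ENNReal.ofReal (((τ : ℕ) : ℝ) * x i τ) = 1
  simp [h]

/-- The random choices made for one arm: its critical delay (`none` for `∞`) and its offset. -/
structure ArmSeed where
  critical : Option ℕ+
  offset : ℕ

instance : MeasurableSpace ArmSeed := ⊤

/-- Given the critical delay `τ`, the offset is uniform on `{0, 1, …, τ - 1}`; an arm with
critical delay `∞` needs no offset. -/
def offsetLaw : Option ℕ+ → PMF ArmSeed
  | none => PMF.pure ⟨none, 0⟩
  | some τ => (PMF.uniformOfFinset (Finset.range (τ : ℕ))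
      (Finset.nonempty_range_iff.2 τ.ne_zero)).map fun r => ⟨some τ, r⟩

/-- The law of all the random choices of the initialization phase, independent over the arms. -/
def seedLaw {k : ℕ} (x : Fin n → ℕ+ → ℝ) (hx : x ∈ lpFeasible n k) :
    Measure (Fin n → ArmSeed) :=
  Measure.pi fun i => ((criticalLaw x hx i).bind offsetLaw).toMeasure

/-! ### Online phase of "Randomize-Then-Interleave" -/

/-- The candidate arms of round `t`: the arms with `t mod τ*_i = r_i`. -/
def candidates (ω : Fin n → ArmSeed) (t : ℕ) : Finset (Fin n) :=
  open Classical in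
  Finset.univ.filter fun i => ∃ τ : ℕ+, (ω i).critical = some τ ∧ t % (τ : ℕ) = (ω i).offset

/-- `A` is a schedule produced by the online phase run with the payoff functions `q` and the random
choices `ω`: in each round it plays a subset of at most `k` candidate arms whose total payoff under
`q`, at the actual delays, is maximum. Ties may be broken in any way. -/
def IsOnlineRun (q : Fin n → ℕ+ → ℝ) (k : ℕ) (ω : Fin n → ArmSeed)
    (A : ℕ → Finset (Fin n)) : Prop :=
  ∀ t : ℕ, 1 ≤ t →
    A t ⊆ candidates ω t ∧ (A t).card ≤ k ∧
    ∀ S ⊆ candidates ω t, S.card ≤ k →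
      ∑ i ∈ S, q i (delay A i t) ≤ ∑ i ∈ A t, q i (delay A i t)

end RechargingBandits

end

/-!
Let `L` be the value of the linear program at `x` for the true payoffs `p`.

*The linear program bounds the optimum.* For any schedule, the frequencies with which arm `i` is
played at delay `τ` during the first `T` rounds form a feasible solution of value (payoff) `/ T`,
because the delays of the plays of one arm sum to at most `T` (`sum_delay_add_delay`). Since `x` is
optimal for payoffs that are `ε`-close to `p`, this gives `opt p k T ≤ (L + 2 k ε) T` (`opt_le`,
`lpValue_le_add`). Only the optimality and feasibility of `x` enter, not its extremality.

*A round earns `γ_k L`.* In each round, arm `i` is a candidate with critical delay `τ` with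
probability exactly `x i τ`, independently over the arms (`armLaw_apply_mod`). From round `τmax` on,
a candidate played at its actual delay pays at least `p i τ`: its candidate rounds are `τ` apart, and
an arm that has never been played is fully recovered (`payoff_critical_le`). As the online phase
maximizes the estimated payoff, the round pays, up to `2 k ε`, the best sum of `k` of the
independent values `p i τ` of the candidates. The expected number of candidates is at most `k`, so
the correlation gap of the uniform matroid of rank `k` (`gammaK_mul_sum_integral_le`) bounds this
expectation below by `γ_k L`. Each of the fewer than `τmax` earlier rounds loses at most `k`.

*The correlation gap.* Writing the best `k`-subset sum as the integral over a threshold `θ` of the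
number of values above `θ`, truncated at `k`, reduces the claim to `E min(k, N) ≥ γ_k E N` for a sum
`N` of independent Bernoulli variables with `E N ≤ k`. Since `min(k, N) = k - (k - N)⁺`, this is an
upper bound on `E (k - N)⁺`. Replacing the Bernoulli variables one by one by Poisson variables of
the same mean only increases it, as the Poisson value is a convex function of the mean and one
Bernoulli step moves along its tangent (`poissonDeficit_bernoulli_le`). Convexity once more compares
the resulting function on `[0, k]` with its chord, whose value at `k` is `k (1 - γ_k)`
(`poissonDeficit_self`, `poissonDeficit_le`).
-/

noncomputable section

namespace RechargingBandits

open ProbabilityTheory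

/-! ### The truncated deficit of a Poisson variable -/

/-- `poissonLT j μ` is the probability that a Poisson variable of mean `μ` is less than `j`. -/
def poissonLT (j : ℕ) (μ : ℝ) : ℝ :=
  Real.exp (-μ) * ∑ m ∈ Finset.range j, μ ^ m / (m.factorial : ℝ)

/-- `poissonDeficit j μ` is the expectation of `(j - Z)⁺` for a Poisson variable `Z` of mean `μ`,
written as `∑_{m ≤ j} P(Z < m)`. -/
def poissonDeficit (j : ℕ) (μ : ℝ) : ℝ := ∑ m ∈ Finset.range j, poissonLT (m + 1) μ

theorem poissonLT_succ (j : ℕ) (μ : ℝ) :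
    poissonLT (j + 1) μ = poissonLT j μ + Real.exp (-μ) * (μ ^ j / (j.factorial : ℝ)) := by
  simp [poissonLT, Finset.sum_range_succ, mul_add]

theorem poissonDeficit_succ (j : ℕ) (μ : ℝ) :
    poissonDeficit (j + 1) μ = poissonDeficit j μ + poissonLT (j + 1) μ := by
  simp [poissonDeficit, Finset.sum_range_succ]

theorem hasDerivAt_poissonLT_succ (j : ℕ) (μ : ℝ) :
    HasDerivAt (poissonLT (j + 1)) (-(Real.exp (-μ) * (μ ^ j / (j.factorial : ℝ)))) μ := by
  have hexp : HasDerivAt (fun y : ℝ => Real.exp (-y)) (-Real.exp (-μ)) μ := by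
    simpa using (hasDerivAt_neg μ).exp
  induction j with
  | zero =>
    have : poissonLT (0 + 1) = fun y : ℝ => Real.exp (-y) := by ext; simp [poissonLT]
    rw [this]
    simpa using hexp
  | succ j ih =>
    have : poissonLT (j + 1 + 1) = fun y : ℝ => poissonLT (j + 1) y +
        Real.exp (-y) * (y ^ (j + 1) / ((j + 1).factorial : ℝ)) := by
      ext y; rw [poissonLT_succ]
    rw [this]
    refine (ih.add (hexp.mul ((hasDerivAt_pow (j + 1) μ).div_const
      ((j + 1).factorial : ℝ)))).congr_deriv ?_
    have : (j.factorial : ℝ) ≠ 0 := by positivity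
    rw [Nat.factorial_succ]
    push_cast
    field_simp
    simp

theorem hasDerivAt_poissonDeficit (j : ℕ) (μ : ℝ) :
    HasDerivAt (poissonDeficit j) (-poissonLT j μ) μ := by
  induction j with
  | zero =>
    have : poissonDeficit 0 = fun _ => 0 := by ext; simp [poissonDeficit]
    rw [this]
    simpa [poissonLT] using hasDerivAt_const μ (0 : ℝ)
  | succ j ih =>
    have : poissonDeficit (j + 1) = fun y : ℝ => poissonDeficit j y + poissonLT (j + 1) y := by
      ext y; rw [poissonDeficit_succ]
    rw [this]
    refine (ih.add (hasDerivAt_poissonLT_succ j μ)).congr_deriv ?_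
    rw [poissonLT_succ]
    ring

theorem antitoneOn_poissonLT (j : ℕ) : AntitoneOn (poissonLT j) (Set.Ici 0) := by
  cases j with
  | zero => intro a _ b _ _; simp [poissonLT]
  | succ j =>
    refine antitoneOn_of_deriv_nonpos (convex_Ici 0)
      (fun y _ => (hasDerivAt_poissonLT_succ j y).continuousAt.continuousWithinAt)
      (fun y _ => (hasDerivAt_poissonLT_succ j y).differentiableAt.differentiableWithinAt) ?_
    intro y hy
    have hy0 : 0 < y := by simpa using hy
    rw [(hasDerivAt_poissonLT_succ j y).deriv]
    have : 0 ≤ Real.exp (-y) * (y ^ j / (j.factorial : ℝ)) := by positivity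
    linarith

theorem convexOn_poissonDeficit (j : ℕ) : ConvexOn ℝ (Set.Ici 0) (poissonDeficit j) := by
  refine MonotoneOn.convexOn_of_deriv (convex_Ici 0)
    (fun y _ => (hasDerivAt_poissonDeficit j y).continuousAt.continuousWithinAt)
    (fun y _ => (hasDerivAt_poissonDeficit j y).differentiableAt.differentiableWithinAt) ?_
  intro a ha b hb hab
  rw [(hasDerivAt_poissonDeficit j a).deriv, (hasDerivAt_poissonDeficit j b).deriv]
  exact neg_le_neg (antitoneOn_poissonLT j (interior_subset ha) (interior_subset hb) hab)

/-- The tangent line of the convex function `poissonDeficit (j + 1)` says that its expected value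
after adding an independent Bernoulli variable of mean `q` to the Poisson variable is at most its
value after adding an independent Poisson variable of mean `q`. -/
theorem poissonDeficit_bernoulli_le (j : ℕ) {μ q : ℝ} (hμ : 0 ≤ μ) (hq : 0 ≤ q) :
    (1 - q) * poissonDeficit (j + 1) μ + q * poissonDeficit j μ ≤
      poissonDeficit (j + 1) (μ + q) := by
  rcases hq.eq_or_lt with rfl | hq
  · simp
  have h := (convexOn_poissonDeficit (j + 1)).le_slope_of_hasDerivAt (x := μ) (y := μ + q) hμ
    (add_nonneg hμ hq.le) (by linarith) (hasDerivAt_poissonDeficit (j + 1) μ)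
  rw [slope_def_field, add_sub_cancel_left, le_div_iff₀ hq] at h
  have := poissonDeficit_succ j μ
  nlinarith

theorem poissonDeficit_succ_eq (j : ℕ) (μ : ℝ) :
    poissonDeficit (j + 1) μ = (j + 1) * poissonLT (j + 1) μ - μ * poissonLT j μ := by
  induction j with
  | zero => simp [poissonDeficit, poissonLT]
  | succ j ih =>
    rw [poissonDeficit_succ, ih, poissonLT_succ (j + 1), poissonLT_succ j, Nat.factorial_succ]
    have : (j.factorial : ℝ) ≠ 0 := by positivity
    push_cast
    field_simp
    ring

theorem poissonDeficit_zero_right (k : ℕ) : poissonDeficit k 0 = k := by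
  have : ∀ m : ℕ, poissonLT (m + 1) 0 = 1 := fun m => by
    simp [poissonLT, Finset.sum_range_succ']
  simp [poissonDeficit, this]

theorem poissonDeficit_self (k : ℕ) : poissonDeficit k k = k * (1 - gammaK k) := by
  cases k with
  | zero => simp [poissonDeficit]
  | succ j =>
    have : (j.factorial : ℝ) ≠ 0 := by positivity
    have he : Real.exp (-((j + 1 : ℕ) : ℝ)) = (Real.exp 1 ^ (j + 1))⁻¹ := by
      rw [Real.exp_neg, Real.exp_one_pow]
    rw [poissonDeficit_succ_eq, poissonLT_succ, he, gammaK, Nat.factorial_succ]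
    push_cast
    field_simp
    ring

/-- The chord of the convex function `poissonDeficit k` over `[0, k]`. -/
theorem poissonDeficit_le (k : ℕ) {μ : ℝ} (h0 : 0 ≤ μ) (hk : μ ≤ k) :
    poissonDeficit k μ ≤ k - gammaK k * μ := by
  rcases Nat.eq_zero_or_pos k with rfl | hpos
  · obtain rfl : μ = 0 := le_antisymm (by simpa using hk) h0
    simp [poissonDeficit]
  have hpos' : (0 : ℝ) < k := by exact_mod_cast hpos
  have h := (convexOn_poissonDeficit k).2 (Set.mem_Ici.2 le_rfl) (Set.mem_Ici.2 hpos'.le)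
    (sub_nonneg.2 ((div_le_one hpos').2 hk)) (div_nonneg h0 hpos'.le) (sub_add_cancel 1 (μ / k))
  simp only [smul_eq_mul, poissonDeficit_zero_right, poissonDeficit_self, mul_zero, zero_add] at h
  rw [div_mul_cancel₀ _ hpos'.ne'] at h
  refine h.trans (le_of_eq ?_)
  field_simp
  ring

theorem gammaK_nonneg (k : ℕ) : 0 ≤ gammaK k := by
  have h := Real.pow_div_factorial_le_exp (k : ℝ) (Nat.cast_nonneg k) k
  rw [gammaK, sub_nonneg, Real.exp_one_pow, mul_comm, ← div_div]
  exact div_le_one_of_le₀ h (Real.exp_pos _).le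

theorem gammaK_le_one (k : ℕ) : gammaK k ≤ 1 := by
  rw [gammaK, sub_le_self_iff]
  positivity

/-! ### Sums of independent Bernoulli variables -/

section Bernoulli

variable {Ω ι : Type*} [MeasurableSpace Ω] {P : Measure Ω} [IsProbabilityMeasure P]

/-- Among the sums of independent `0`-`1` variables of a given mean, the Poisson limit has the
largest truncated deficit; natural subtraction is the positive part. -/
theorem integral_sub_sum_le_poissonDeficit {X : ι → Ω → ℕ} (hX : ∀ i, Measurable (X i))
    (hind : iIndepFun X P) (h01 : ∀ i ω, X i ω ≤ 1) (s : Finset ι) (j : ℕ) :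
    ∫ ω, ((j - ∑ i ∈ s, X i ω : ℕ) : ℝ) ∂P ≤ poissonDeficit j (∑ i ∈ s, ∫ ω, (X i ω : ℝ) ∂P) := by
  classical
  induction s using Finset.induction_on generalizing j with
  | empty => simp [poissonDeficit_zero_right]
  | insert a s ha ih =>
    cases j with
    | zero => simp [poissonDeficit]
    | succ j =>
      set N : Ω → ℕ := ∑ i ∈ s, X i with hN
      have hNm : Measurable N := by
        rw [hN, Finset.sum_fn]
        exact Finset.measurable_sum _ fun i _ => hX i
      have hNX : IndepFun N (X a) P := hind.indepFun_finsetSum_of_notMem hX ha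
      have hf : ∀ m : ℕ, Measurable fun ω => ((m - N ω : ℕ) : ℝ) := fun m =>
        (measurable_of_countable fun r : ℕ => ((m - r : ℕ) : ℝ)).comp hNm
      have hXm : Measurable fun ω => (X a ω : ℝ) :=
        (measurable_of_countable fun r : ℕ => (r : ℝ)).comp (hX a)
      have hfi : ∀ m : ℕ, Integrable (fun ω => ((m - N ω : ℕ) : ℝ)) P := fun m =>
        Integrable.of_bound (hf m).aestronglyMeasurable (m : ℝ) (.of_forall fun ω => by
          rw [Real.norm_of_nonneg (Nat.cast_nonneg _)]
          exact_mod_cast Nat.sub_le _ _)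
      have hmulfi : ∀ m : ℕ, Integrable (fun ω => ((m - N ω : ℕ) : ℝ) * (X a ω : ℝ)) P := fun m =>
        Integrable.of_bound ((hf m).mul hXm).aestronglyMeasurable (m : ℝ) (.of_forall fun ω => by
          rw [Real.norm_of_nonneg (by positivity)]
          exact_mod_cast (Nat.mul_le_mul (Nat.sub_le _ _) (h01 a ω)).trans_eq (mul_one _))
      have hmul : ∀ m : ℕ, ∫ ω, ((m - N ω : ℕ) : ℝ) * (X a ω : ℝ) ∂P =
          (∫ ω, ((m - N ω : ℕ) : ℝ) ∂P) * ∫ ω, (X a ω : ℝ) ∂P := fun m =>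
        IndepFun.integral_fun_mul_eq_mul_integral
          (hNX.comp (φ := fun r : ℕ => ((m - r : ℕ) : ℝ)) (ψ := fun r : ℕ => (r : ℝ))
            (measurable_of_countable _) (measurable_of_countable _))
          (hf m).aestronglyMeasurable hXm.aestronglyMeasurable
      have hsum : ∀ ω, ∑ i ∈ s, X i ω = N ω := fun ω => by rw [hN, Finset.sum_apply]
      have hpt : ∀ ω, ((j + 1 - ∑ i ∈ insert a s, X i ω : ℕ) : ℝ) =
          ((j + 1 - N ω : ℕ) : ℝ) - ((j + 1 - N ω : ℕ) : ℝ) * (X a ω : ℝ)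
            + ((j - N ω : ℕ) : ℝ) * (X a ω : ℝ) := by
        intro ω
        rw [Finset.sum_insert ha, hsum]
        rcases Nat.le_one_iff_eq_zero_or_eq_one.1 (h01 a ω) with h | h
        · simp [h]
        · rw [h, show j + 1 - (1 + N ω) = j - N ω by omega]
          simp
      have hint : Integrable (fun ω => ((j + 1 - N ω : ℕ) : ℝ)
          - ((j + 1 - N ω : ℕ) : ℝ) * (X a ω : ℝ)) P := (hfi _).sub (hmulfi _)
      have hq0 : 0 ≤ ∫ ω, (X a ω : ℝ) ∂P := integral_nonneg fun ω => Nat.cast_nonneg _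
      have hq1 : ∫ ω, (X a ω : ℝ) ∂P ≤ 1 := by
        have := integral_mono_of_nonneg (μ := P) (f := fun ω => (X a ω : ℝ)) (g := fun _ => (1 : ℝ))
          (.of_forall fun ω => Nat.cast_nonneg _) (integrable_const _)
          (.of_forall fun ω => Nat.cast_le_one.2 (h01 a ω))
        simpa using this
      have ih1 := ih (j + 1)
      have ih0 := ih j
      simp only [hsum] at ih1 ih0
      rw [integral_congr_ae (.of_forall hpt), integral_add hint (hmulfi _),
        integral_sub (hfi _) (hmulfi _), hmul, hmul, Finset.sum_insert ha, add_comm (∫ _, _ ∂_)]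
      refine le_trans ?_ (poissonDeficit_bernoulli_le j
        (Finset.sum_nonneg fun i _ => integral_nonneg fun ω => Nat.cast_nonneg _) hq0)
      nlinarith [mul_le_mul_of_nonneg_left ih1 (sub_nonneg.2 hq1),
        mul_le_mul_of_nonneg_left ih0 hq0]

/-- The correlation gap of the rank function of a uniform matroid: a sum of independent `0`-`1`
variables whose mean is at most `k` keeps a fraction `γ_k` of its mean when truncated at `k`. -/
theorem gammaK_mul_le_integral_min {X : ι → Ω → ℕ} (hX : ∀ i, Measurable (X i))
    (hind : iIndepFun X P) (h01 : ∀ i ω, X i ω ≤ 1) (s : Finset ι) (k : ℕ)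
    (hk : ∑ i ∈ s, ∫ ω, (X i ω : ℝ) ∂P ≤ k) :
    gammaK k * ∑ i ∈ s, ∫ ω, (X i ω : ℝ) ∂P ≤
      ∫ ω, ((min k (∑ i ∈ s, X i ω) : ℕ) : ℝ) ∂P := by
  have hNm : Measurable fun ω => ∑ i ∈ s, X i ω := Finset.measurable_sum _ fun i _ => hX i
  have hpt : ∀ ω, ((min k (∑ i ∈ s, X i ω) : ℕ) : ℝ) =
      (k : ℝ) - ((k - ∑ i ∈ s, X i ω : ℕ) : ℝ) := fun ω => by
    rw [eq_sub_iff_add_eq]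
    norm_cast
    omega
  have hi : Integrable (fun ω => ((k - ∑ i ∈ s, X i ω : ℕ) : ℝ)) P :=
    Integrable.of_bound
      ((measurable_of_countable fun r : ℕ => ((k - r : ℕ) : ℝ)).comp hNm).aestronglyMeasurable
      (k : ℝ) (.of_forall fun ω => by
        rw [Real.norm_of_nonneg (Nat.cast_nonneg _)]
        exact_mod_cast Nat.sub_le _ _)
  rw [integral_congr_ae (.of_forall hpt), integral_sub (integrable_const _) hi]
  have h1 := integral_sub_sum_le_poissonDeficit hX hind h01 s k
  have h2 := poissonDeficit_le k
    (Finset.sum_nonneg fun i _ => integral_nonneg fun ω => Nat.cast_nonneg (X i ω)) hk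
  simp only [integral_const, probReal_univ, smul_eq_mul, one_mul]
  linarith

end Bernoulli

/-! ### The correlation gap for the best `k` of independent values -/

/-- A `k`-subset with the largest values contains, for every threshold, as many values above the
threshold as any `k`-subset can. -/
theorem exists_subset_card_le_forall_min_le {ι : Type*} [DecidableEq ι] (v : ι → ℝ) (k : ℕ)
    (C : Finset ι) :
    ∃ S ⊆ C, S.card ≤ k ∧
      ∀ θ : ℝ, min k (∑ i ∈ C, if θ < v i then 1 else 0) ≤ ∑ i ∈ S, if θ < v i then 1 else 0 := by
  induction k generalizing C with
  | zero => exact ⟨∅, by simp⟩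
  | succ k ih =>
    rcases C.eq_empty_or_nonempty with rfl | hC
    · exact ⟨∅, by simp⟩
    obtain ⟨a, ha, hmax⟩ := C.exists_max_image v hC
    obtain ⟨S, hSC, hSk, hS⟩ := ih (C.erase a)
    have haS : a ∉ S := fun h => by simpa using hSC h
    refine ⟨insert a S, Finset.insert_subset ha (hSC.trans (Finset.erase_subset _ _)), ?_, ?_⟩
    · rw [Finset.card_insert_of_notMem haS]
      omega
    intro θ
    rw [Finset.sum_insert haS, ← Finset.add_sum_erase C _ ha]
    have := hS θ
    by_cases hθ : θ < v a
    · simp only [hθ, if_true]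
      omega
    · have h0 : ∑ i ∈ C.erase a, (if θ < v i then 1 else 0) = 0 :=
        Finset.sum_eq_zero fun i hi =>
          if_neg (not_lt.2 ((hmax i (Finset.mem_of_mem_erase hi)).trans (not_lt.1 hθ)))
      rw [if_neg hθ, h0]
      simp

theorem integral_threshold {v : ℝ} (h0 : 0 ≤ v) (h1 : v ≤ 1) :
    ∫ θ, ((if θ < v then 1 else 0 : ℕ) : ℝ) ∂(volume.restrict (Set.Ioo (0 : ℝ) 1)) = v := by
  have : (fun θ : ℝ => ((if θ < v then 1 else 0 : ℕ) : ℝ)) =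
      (Set.Iio v).indicator fun _ => (1 : ℝ) := by
    ext θ
    by_cases h : θ < v <;> simp [h]
  rw [this, integral_indicator measurableSet_Iio, setIntegral_const,
    measureReal_restrict_apply measurableSet_Iio]
  have hset : Set.Iio v ∩ Set.Ioo (0 : ℝ) 1 = Set.Ioo 0 v := by
    ext θ
    simp only [Set.mem_inter_iff, Set.mem_Iio, Set.mem_Ioo]
    constructor
    · rintro ⟨a, b, -⟩; exact ⟨b, a⟩
    · rintro ⟨a, b⟩; exact ⟨b, a, b.trans_le h1⟩
  simp [hset, h0]

theorem integrable_threshold (v : ℝ) :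
    Integrable (fun θ : ℝ => ((if θ < v then 1 else 0 : ℕ) : ℝ))
      (volume.restrict (Set.Ioo (0 : ℝ) 1)) :=
  Integrable.of_bound
    ((measurable_of_countable fun r : ℕ => (r : ℝ)).comp
      (Measurable.ite measurableSet_Iio measurable_const measurable_const)).aestronglyMeasurable 1
    (.of_forall fun θ => by split_ifs <;> simp)

section Values

variable {ι : Type*}

/-- The total value of the best `k`-subset is at least the integral over the threshold `θ` of the
number of values above `θ`, truncated at `k`. -/
theorem exists_subset_integral_min_le [Fintype ι] {v : ι → ℝ} (h0 : ∀ i, 0 ≤ v i)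
    (h1 : ∀ i, v i ≤ 1) (k : ℕ) :
    ∃ S : Finset ι, S.card ≤ k ∧
      ∫ θ, ((min k (∑ i, if θ < v i then 1 else 0) : ℕ) : ℝ)
        ∂(volume.restrict (Set.Ioo (0 : ℝ) 1)) ≤ ∑ i ∈ S, v i := by
  classical
  obtain ⟨S, -, hSk, hS⟩ := exists_subset_card_le_forall_min_le v k Finset.univ
  refine ⟨S, hSk, ?_⟩
  calc _ ≤ ∫ θ, ∑ i ∈ S, ((if θ < v i then 1 else 0 : ℕ) : ℝ)
        ∂(volume.restrict (Set.Ioo (0 : ℝ) 1)) := by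
        refine integral_mono_of_nonneg (.of_forall fun θ => Nat.cast_nonneg _)
          (integrable_finsetSum _ fun i _ => integrable_threshold _) (.of_forall fun θ => ?_)
        simp only [← Nat.cast_sum]
        exact Nat.cast_le.2 (hS θ)
    _ = ∑ i ∈ S, v i := by
        rw [integral_finsetSum _ fun i _ => integrable_threshold _]
        exact Finset.sum_congr rfl fun i _ => integral_threshold (h0 i) (h1 i)

variable {Ω : Type*} [MeasurableSpace Ω] {P : Measure Ω} [IsProbabilityMeasure P]

/-- The correlation gap for independent values `V i ∈ [0, 1]`: if the expected number of nonzero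
values is at most `k`, then the expected value of the best `k`-subset is at least `γ_k` times the
expected total value. The number of nonzero values is bounded through variables `B i`, which are at
least `1` where `V i` is positive. -/
theorem gammaK_mul_sum_integral_le [Fintype ι] {V B : ι → Ω → ℝ} (hV : ∀ i, Measurable (V i))
    (hind : iIndepFun V P) (h0 : ∀ i ω, 0 ≤ V i ω) (h1 : ∀ i ω, V i ω ≤ 1)
    (hB : ∀ i, Integrable (B i) P) (hB0 : ∀ i ω, 0 ≤ B i ω)
    (hB1 : ∀ i ω, 0 < V i ω → 1 ≤ B i ω) {k : ℕ} (hk : ∑ i, ∫ ω, B i ω ∂P ≤ k)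
    {W : Ω → ℝ} (hW : Integrable W P)
    (hWV : ∀ ω (S : Finset ι), S.card ≤ k → ∑ i ∈ S, V i ω ≤ W ω) :
    gammaK k * ∑ i, ∫ ω, V i ω ∂P ≤ ∫ ω, W ω ∂P := by
  set ν : Measure ℝ := volume.restrict (Set.Ioo (0 : ℝ) 1) with hν
  set X : ℝ → ι → Ω → ℕ := fun θ i ω => if θ < V i ω then 1 else 0 with hXdef
  have hX01 : ∀ θ i ω, X θ i ω ≤ 1 := fun θ i ω => by simp only [hXdef]; split_ifs <;> simp
  have hXjoint : ∀ i, Measurable fun z : Ω × ℝ => X z.2 i z.1 := fun i =>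
    Measurable.ite (measurableSet_lt measurable_snd ((hV i).comp measurable_fst))
      measurable_const measurable_const
  have hX : ∀ θ i, Measurable (X θ i) := fun θ i =>
    (hXjoint i).comp (measurable_id.prodMk measurable_const)
  have hcast : Measurable fun r : ℕ => (r : ℝ) := measurable_of_countable _
  have hXi : ∀ i, Integrable (fun z : Ω × ℝ => (X z.2 i z.1 : ℝ)) (P.prod ν) := fun i =>
    Integrable.of_bound (hcast.comp (hXjoint i)).aestronglyMeasurable 1
      (.of_forall fun z => by
        rw [Real.norm_of_nonneg (Nat.cast_nonneg _)]
        exact_mod_cast hX01 _ _ _)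
  have hMi : Integrable (fun z : Ω × ℝ => ((min k (∑ i, X z.2 i z.1) : ℕ) : ℝ)) (P.prod ν) :=
    Integrable.of_bound
      (hcast.comp (measurable_const.min
        (Finset.measurable_sum _ fun i _ => hXjoint i))).aestronglyMeasurable k
      (.of_forall fun z => by
        rw [Real.norm_of_nonneg (Nat.cast_nonneg _)]
        exact_mod_cast min_le_left _ _)
  have hthreshold : ∀ θ ∈ Set.Ioo (0 : ℝ) 1,
      gammaK k * ∑ i, ∫ ω, (X θ i ω : ℝ) ∂P ≤
        ∫ ω, ((min k (∑ i, X θ i ω) : ℕ) : ℝ) ∂P := by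
    intro θ hθ
    refine gammaK_mul_le_integral_min (hX θ) ?_ (hX01 θ) Finset.univ k ?_
    · exact hind.comp (fun _ v => if θ < v then 1 else 0) fun _ =>
        Measurable.ite measurableSet_Ioi measurable_const measurable_const
    · refine le_trans (Finset.sum_le_sum fun i _ => ?_) hk
      refine integral_mono_of_nonneg (.of_forall fun ω => Nat.cast_nonneg _) (hB i)
        (.of_forall fun ω => ?_)
      by_cases h : θ < V i ω
      · simpa [hXdef, h] using hB1 i ω (hθ.1.trans h)
      · simpa [hXdef, h] using hB0 i ω
  calc gammaK k * ∑ i, ∫ ω, V i ω ∂P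
      = ∫ θ, gammaK k * ∑ i, ∫ ω, (X θ i ω : ℝ) ∂P ∂ν := by
        rw [integral_const_mul, integral_finsetSum _ fun i _ => (hXi i).integral_prod_right]
        congr 1
        refine Finset.sum_congr rfl fun i _ => ?_
        rw [← integral_integral_swap (f := fun ω θ => (X θ i ω : ℝ)) (hXi i)]
        exact integral_congr_ae (.of_forall fun ω => (integral_threshold (h0 i ω) (h1 i ω)).symm)
    _ ≤ ∫ θ, ∫ ω, ((min k (∑ i, X θ i ω) : ℕ) : ℝ) ∂P ∂ν := by
        refine integral_mono_ae
          ((integrable_finsetSum _ fun i _ => (hXi i).integral_prod_right).const_mul _)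
          hMi.integral_prod_right ?_
        filter_upwards [ae_restrict_mem measurableSet_Ioo] with θ hθ using hthreshold θ hθ
    _ = ∫ ω, ∫ θ, ((min k (∑ i, X θ i ω) : ℕ) : ℝ) ∂ν ∂P :=
        (integral_integral_swap
          (f := fun ω θ => ((min k (∑ i, X θ i ω) : ℕ) : ℝ)) hMi).symm
    _ ≤ ∫ ω, W ω ∂P := by
        refine integral_mono hMi.integral_prod_left hW fun ω => ?_
        obtain ⟨S, hSk, hS⟩ := exists_subset_integral_min_le (h0 · ω) (h1 · ω) k
        exact hS.trans (hWV ω S hSk)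

end Values

/-! ### The random choices of a single arm -/

variable {n k : ℕ}

/-- `candidateValue g t s` is `g τ` if the arm with random choices `s` has critical delay `τ` and
is a candidate in round `t`; it is `0` if the arm is not a candidate. -/
def candidateValue (g : ℕ+ → ℝ) (t : ℕ) (s : ArmSeed) : ℝ :=
  match s.critical with
  | some τ => if t % (τ : ℕ) = s.offset then g τ else 0
  | none => 0

theorem candidateValue_nonneg {g : ℕ+ → ℝ} (hg : ∀ τ, 0 ≤ g τ) (t : ℕ) (s : ArmSeed) :
    0 ≤ candidateValue g t s := by
  unfold candidateValue
  split
  · split_ifs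
    exacts [hg _, le_rfl]
  · exact le_rfl

theorem candidateValue_le_one {g : ℕ+ → ℝ} (hg : ∀ τ, g τ ≤ 1) (t : ℕ) (s : ArmSeed) :
    candidateValue g t s ≤ 1 := by
  unfold candidateValue
  split
  · split_ifs
    exacts [hg _, zero_le_one]
  · exact zero_le_one

instance : Countable ArmSeed :=
  Function.Injective.countable (f := fun s : ArmSeed => (s.critical, s.offset)) fun s s' h => by
    cases s; cases s'; simpa using h

instance : DiscreteMeasurableSpace ArmSeed := ⟨fun _ => trivial⟩

theorem offsetLaw_apply_of_ne {d : Option ℕ+} {s : ArmSeed} (h : s.critical ≠ d) :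
    offsetLaw d s = 0 := by
  rw [PMF.apply_eq_zero_iff]
  intro hs
  cases d with
  | none =>
    simp only [offsetLaw, PMF.support_pure, Set.mem_singleton_iff] at hs
    simp [hs] at h
  | some τ =>
    simp only [offsetLaw, PMF.support_map, Set.mem_image] at hs
    obtain ⟨r, -, rfl⟩ := hs
    simp at h

theorem offsetLaw_apply_mod (τ : ℕ+) (t : ℕ) :
    offsetLaw (some τ) ⟨some τ, t % (τ : ℕ)⟩ = ((τ : ℕ) : ENNReal)⁻¹ := by
  rw [offsetLaw, PMF.map_apply, tsum_eq_single (t % (τ : ℕ))]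
  · rw [if_pos rfl, PMF.uniformOfFinset_apply_of_mem _ (Finset.mem_range.2 (Nat.mod_lt _ τ.pos)),
      Finset.card_range]
  · intro r hr
    rw [if_neg]
    simpa using hr.symm

/-- In every round, an arm has critical delay `τ` and is a candidate with probability
`τ x_τ · (1 / τ) = x_τ`. -/
theorem armLaw_apply_mod {x : Fin n → ℕ+ → ℝ} (hx : x ∈ lpFeasible n k) (i : Fin n) (τ : ℕ+)
    (t : ℕ) :
    ((criticalLaw x hx i).bind offsetLaw) ⟨some τ, t % (τ : ℕ)⟩ = ENNReal.ofReal (x i τ) := by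
  rw [PMF.bind_apply, tsum_eq_single (some τ)]
  · rw [offsetLaw_apply_mod]
    change ENNReal.ofReal (((τ : ℕ) : ℝ) * x i τ) * _ = _
    rw [ENNReal.ofReal_mul (Nat.cast_nonneg _), ENNReal.ofReal_natCast, mul_comm, ← mul_assoc,
      ENNReal.inv_mul_cancel (by simp) (by simp), one_mul]
  · intro d hd
    rw [offsetLaw_apply_of_ne (Ne.symm hd), mul_zero]

theorem integrable_candidateValue {g : ℕ+ → ℝ} (h0 : ∀ τ, 0 ≤ g τ) (h1 : ∀ τ, g τ ≤ 1)
    (t : ℕ) (μ : Measure ArmSeed) [IsFiniteMeasure μ] : Integrable (candidateValue g t) μ :=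
  Integrable.of_bound (measurable_of_countable _).aestronglyMeasurable 1 (.of_forall fun s => by
    rw [Real.norm_of_nonneg (candidateValue_nonneg h0 t s)]
    exact candidateValue_le_one h1 t s)

theorem summable_mul_of_mem_Icc {x g : ℕ+ → ℝ} (hx0 : ∀ τ, 0 ≤ x τ) (hx : Summable x)
    (h0 : ∀ τ, 0 ≤ g τ) (h1 : ∀ τ, g τ ≤ 1) : Summable fun τ => g τ * x τ :=
  Summable.of_nonneg_of_le (fun τ => mul_nonneg (h0 τ) (hx0 τ))
    (fun τ => mul_le_of_le_one_left (hx0 τ) (h1 τ)) hx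

theorem integral_candidateValue {x : Fin n → ℕ+ → ℝ} (hx : x ∈ lpFeasible n k) (i : Fin n)
    {g : ℕ+ → ℝ} (h0 : ∀ τ, 0 ≤ g τ) (h1 : ∀ τ, g τ ≤ 1) (t : ℕ) :
    ∫ s, candidateValue g t s ∂((criticalLaw x hx i).bind offsetLaw).toMeasure =
      ∑' τ, g τ * x i τ := by
  have hinj : Function.Injective fun τ : ℕ+ => (⟨some τ, t % (τ : ℕ)⟩ : ArmSeed) := fun a b h => by
    simpa using congrArg ArmSeed.critical h
  rw [integral_eq_lintegral_of_nonneg_ae (.of_forall fun s => candidateValue_nonneg h0 t s)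
    (measurable_of_countable _).aestronglyMeasurable, lintegral_countable', ← hinj.tsum_eq]
  · have : ∀ τ : ℕ+, ENNReal.ofReal (candidateValue g t ⟨some τ, t % (τ : ℕ)⟩) *
        ((criticalLaw x hx i).bind offsetLaw).toMeasure {⟨some τ, t % (τ : ℕ)⟩} =
        ENNReal.ofReal (g τ * x i τ) := fun τ => by
      rw [PMF.toMeasure_apply_singleton _ _ (measurableSet_singleton _), armLaw_apply_mod,
        ENNReal.ofReal_mul (h0 τ)]
      simp [candidateValue]
    simp only [this]
    rw [← ENNReal.ofReal_tsum_of_nonneg (fun τ => mul_nonneg (h0 τ) (hx.1 i τ))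
        (summable_mul_of_mem_Icc (hx.1 i) (hx.2.1 i) h0 h1),
      ENNReal.toReal_ofReal (tsum_nonneg fun τ => mul_nonneg (h0 τ) (hx.1 i τ))]
  · intro s hs
    obtain ⟨d, r⟩ := s
    cases d with
    | none => simp [candidateValue] at hs
    | some τ =>
      by_cases h : t % (τ : ℕ) = r
      · exact ⟨τ, by simp [h]⟩
      · simp [candidateValue, h] at hs

/-! ### Delays -/

/-- The delays of an arm up to its last play before round `T + 1`, together with its current delay,
partition the rounds `1, …, T + 1`. -/
theorem sum_delay_add_delay (A : ℕ → Finset (Fin n)) (i : Fin n) (T : ℕ) :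
    (∑ t ∈ Finset.Icc 1 T, if i ∈ A t then (delay A i t : ℕ) else 0) + (delay A i (T + 1) : ℕ) =
      T + 1 := by
  induction T with
  | zero => simp [delay]
  | succ T ih =>
    rw [Finset.sum_Icc_succ_top (by omega)]
    have hd : delay A i (T + 1 + 1) = if i ∈ A (T + 1) then 1 else delay A i (T + 1) + 1 := by
      rw [delay]
      simp
    rw [hd]
    split_ifs
    · rw [PNat.one_coe]; omega
    · rw [PNat.add_coe, PNat.one_coe]; omega

theorem delay_eq_or_exists (A : ℕ → Finset (Fin n)) (i : Fin n) (t : ℕ) :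
    (delay A i (t + 1) : ℕ) = t + 1 ∨
      ∃ s, 1 ≤ s ∧ i ∈ A s ∧ s + (delay A i (t + 1) : ℕ) = t + 1 := by
  induction t with
  | zero => left; simp [delay]
  | succ t ih =>
    have hd : delay A i (t + 1 + 1) = if i ∈ A (t + 1) then 1 else delay A i (t + 1) + 1 := by
      rw [delay]
      simp
    rw [hd]
    split_ifs with h
    · exact Or.inr ⟨t + 1, by omega, h, by simp⟩
    · rw [PNat.add_coe, PNat.one_coe]
      rcases ih with h | ⟨s, h1, h2, h3⟩
      · left; omega
      · exact Or.inr ⟨s, h1, h2, by omega⟩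

/-- The candidate rounds of an arm are spaced by its critical delay. -/
theorem min_critical_le_delay {q : Fin n → ℕ+ → ℝ} {ω : Fin n → ArmSeed}
    {A : ℕ → Finset (Fin n)} (hA : IsOnlineRun q k ω A) {i : Fin n} {τ : ℕ+} {t : ℕ} (ht : 1 ≤ t)
    (hc : (ω i).critical = some τ) (hr : t % (τ : ℕ) = (ω i).offset) :
    min (τ : ℕ) t ≤ (delay A i t : ℕ) := by
  obtain ⟨t, rfl⟩ := Nat.exists_eq_add_of_le' ht
  rcases delay_eq_or_exists A i t with h | ⟨s, h1, h2, h3⟩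
  · exact (min_le_right _ _).trans h.ge
  · refine (min_le_left _ _).trans ?_
    have hs := (hA s h1).1 h2
    simp only [candidates, Finset.mem_filter, Finset.mem_univ, true_and] at hs
    obtain ⟨τ', hc', hr'⟩ := hs
    obtain rfl : τ = τ' := by simpa [hc] using hc'
    have hdvd : (τ : ℕ) ∣ t + 1 - s :=
      (Nat.modEq_iff_dvd' (by omega)).1 (show s ≡ t + 1 [MOD τ] from hr'.trans hr.symm)
    have hpos := (delay A i (t + 1)).pos
    have := Nat.le_of_dvd (by omega) hdvd
    omega

/-- From round `τmax` on, the payoff at the actual delay is at least that at the critical delay: an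
arm that has been played before has recovered for `τ` rounds, any other arm is fully recovered. -/
theorem payoff_critical_le {p q : Fin n → ℕ+ → ℝ} (hmono : ∀ i, Monotone (p i)) {τmax : ℕ+}
    (hrec : ∀ i τ, τmax ≤ τ → p i τ = p i τmax) {ω : Fin n → ArmSeed}
    {A : ℕ → Finset (Fin n)} (hA : IsOnlineRun q k ω A) {i : Fin n} {τ : ℕ+} {t : ℕ}
    (ht : (τmax : ℕ) ≤ t) (hc : (ω i).critical = some τ)
    (hr : t % (τ : ℕ) = (ω i).offset) :
    p i τ ≤ p i (delay A i t) := by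
  rcases min_le_iff.1 (min_critical_le_delay hA (τmax.pos.trans_le ht) hc hr) with h | h
  · exact hmono i (PNat.coe_le_coe _ _ |>.1 h)
  · rw [hrec i (delay A i t) ((PNat.coe_le_coe _ _).1 (ht.trans h)),
      ← hrec i (max τ τmax) (le_max_right _ _)]
    exact hmono i (le_max_left _ _)

/-! ### The payoff of the online phase -/

/-- From round `τmax` on, the payoff of a round is, up to the estimation error, at least the sum of
the payoffs at the critical delays over any `k` candidates. -/
theorem sum_candidateValue_le {p q : Fin n → ℕ+ → ℝ} (hmono : ∀ i, Monotone (p i))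
    {τmax : ℕ+} (hrec : ∀ i τ, τmax ≤ τ → p i τ = p i τmax)
    {ε : ℝ} (hε : 0 ≤ ε) (hq : ∀ i τ, |q i τ - p i τ| ≤ ε) {ω : Fin n → ArmSeed}
    {A : ℕ → Finset (Fin n)} (hA : IsOnlineRun q k ω A) {t : ℕ} (ht : (τmax : ℕ) ≤ t)
    {S : Finset (Fin n)} (hS : S.card ≤ k) :
    ∑ i ∈ S, candidateValue (p i) t (ω i) ≤
      ∑ i ∈ A t, p i (delay A i t) + 2 * k * ε := by
  classical
  obtain ⟨-, hAk, hopt⟩ := hA t (τmax.pos.trans_le ht)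
  set R := S.filter (· ∈ candidates ω t) with hR
  have hRk : R.card ≤ k := (Finset.card_filter_le _ _).trans hS
  have hcard : ∀ F : Finset (Fin n), F.card ≤ k → ∑ _i ∈ F, ε ≤ k * ε := fun F hF => by
    rw [Finset.sum_const, nsmul_eq_mul]
    exact mul_le_mul_of_nonneg_right (by exact_mod_cast hF) hε
  have h1 : ∑ i ∈ S, candidateValue (p i) t (ω i) ≤ ∑ i ∈ R, p i (delay A i t) := by
    rw [hR, Finset.sum_filter]
    refine Finset.sum_le_sum fun i _ => ?_
    split_ifs with hi
    · simp only [candidates, Finset.mem_filter, Finset.mem_univ, true_and] at hi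
      obtain ⟨τ, hc, hr⟩ := hi
      simpa [candidateValue, hc, hr] using payoff_critical_le hmono hrec hA ht hc hr
    · simp only [candidates, Finset.mem_filter, Finset.mem_univ, true_and, not_exists,
        not_and] at hi
      unfold candidateValue
      split
      · next τ hc => rw [if_neg (hi τ hc)]
      · exact le_rfl
  have h2 : ∑ i ∈ R, p i (delay A i t) ≤ ∑ i ∈ R, q i (delay A i t) + ∑ _i ∈ R, ε := by
    rw [← Finset.sum_add_distrib]
    exact Finset.sum_le_sum fun i _ => by linarith [(abs_le.1 (hq i (delay A i t))).1]
  have h3 : ∑ i ∈ A t, q i (delay A i t) ≤ ∑ i ∈ A t, p i (delay A i t) + ∑ _i ∈ A t, ε := by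
    rw [← Finset.sum_add_distrib]
    exact Finset.sum_le_sum fun i _ => by linarith [(abs_le.1 (hq i (delay A i t))).2]
  have h4 := hopt R (fun i hi => (Finset.mem_filter.1 hi).2) hRk
  have h5 := hcard R hRk
  have h6 := hcard (A t) hAk
  linarith

instance isProbabilityMeasure_seedLaw (x : Fin n → ℕ+ → ℝ) (hx : x ∈ lpFeasible n k) :
    IsProbabilityMeasure (seedLaw x hx) := by
  unfold seedLaw
  infer_instance

theorem integral_seedLaw_eval {x : Fin n → ℕ+ → ℝ} (hx : x ∈ lpFeasible n k) (i : Fin n)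
    (f : ArmSeed → ℝ) :
    ∫ ω, f (ω i) ∂(seedLaw x hx) =
      ∫ s, f s ∂((criticalLaw x hx i).bind offsetLaw).toMeasure := by
  have h := measurePreserving_eval
    (fun i => ((criticalLaw x hx i).bind offsetLaw).toMeasure) i
  rw [← h.map_eq, integral_map h.measurable.aemeasurable
    (measurable_of_countable f).aestronglyMeasurable]
  rfl

/-- A single round from `τmax` on earns, in expectation, a fraction `γ_k` of the value of the linear
program, up to the estimation error. -/
theorem gammaK_mul_lpValue_le_integral_round {p q : Fin n → ℕ+ → ℝ}
    (hp : ∀ i τ, p i τ ∈ Set.Icc (0 : ℝ) 1) (hmono : ∀ i, Monotone (p i)) {τmax : ℕ+}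
    (hrec : ∀ i τ, τmax ≤ τ → p i τ = p i τmax)
    {ε : ℝ} (hε : 0 ≤ ε) (hq : ∀ i τ, |q i τ - p i τ| ≤ ε)
    {x : Fin n → ℕ+ → ℝ} (hx : x ∈ lpFeasible n k)
    {A : (Fin n → ArmSeed) → ℕ → Finset (Fin n)} (hA : ∀ ω, IsOnlineRun q k ω (A ω))
    {t : ℕ} (ht : (τmax : ℕ) ≤ t)
    (hint : Integrable (fun ω => ∑ i ∈ A ω t, p i (delay (A ω) i t)) (seedLaw x hx)) :
    gammaK k * lpValue p x - 2 * k * ε ≤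
      ∫ ω, ∑ i ∈ A ω t, p i (delay (A ω) i t) ∂(seedLaw x hx) := by
  have hp0 := fun i τ => (hp i τ).1
  have hp1 := fun i τ => (hp i τ).2
  have hmain := gammaK_mul_sum_integral_le (P := seedLaw x hx) (k := k)
    (V := fun i ω => candidateValue (p i) t (ω i))
    (B := fun i ω => candidateValue (fun _ => 1) t (ω i))
    (W := fun ω => ∑ i ∈ A ω t, p i (delay (A ω) i t) + 2 * k * ε)
    (fun i => measurable_of_countable _)
    (iIndepFun_pi fun i => (measurable_of_countable _).aemeasurable)
    (fun i ω => candidateValue_nonneg (hp0 i) t (ω i))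
    (fun i ω => candidateValue_le_one (hp1 i) t (ω i))
    (fun i => (measurePreserving_eval
        (fun i => ((criticalLaw x hx i).bind offsetLaw).toMeasure) i).integrable_comp_of_integrable
      (integrable_candidateValue (fun _ => zero_le_one) (fun _ => le_rfl) t _))
    (fun i ω => candidateValue_nonneg (by simp) t (ω i))
    (fun i ω hpos => by
      unfold candidateValue at hpos ⊢
      split at hpos
      · split_ifs at hpos ⊢
        · exact le_rfl
        · exact absurd hpos (lt_irrefl _)
      · exact absurd hpos (lt_irrefl _))
    (by
      simp only [integral_seedLaw_eval hx _ (candidateValue _ t),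
        integral_candidateValue hx _ (g := fun _ => (1 : ℝ)) (by simp) (by simp), one_mul]
      exact hx.2.2.1)
    (hint.add (integrable_const _))
    (fun ω S hS => sum_candidateValue_le hmono hrec hε hq (hA ω) ht hS)
  rw [integral_add hint (integrable_const _)] at hmain
  simp only [integral_seedLaw_eval hx _ (candidateValue _ t),
    integral_candidateValue hx _ (hp0 _) (hp1 _), integral_const, probReal_univ, one_smul] at hmain
  rw [lpValue]
  linarith

/-! ### The linear program as an upper bound -/

/-- The fraction of the rounds `1, …, T` in which arm `i` is played at delay `τ`. -/
def playFrequency (A : ℕ → Finset (Fin n)) (T : ℕ) (i : Fin n) (τ : ℕ+) : ℝ :=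
  ∑ t ∈ Finset.Icc 1 T, if τ = delay A i t then (if i ∈ A t then (T : ℝ)⁻¹ else 0) else 0

theorem hasSum_mul_playFrequency (A : ℕ → Finset (Fin n)) (T : ℕ) (i : Fin n) (g : ℕ+ → ℝ) :
    HasSum (fun τ => g τ * playFrequency A T i τ)
      (∑ t ∈ Finset.Icc 1 T, if i ∈ A t then g (delay A i t) * (T : ℝ)⁻¹ else 0) := by
  simp only [playFrequency, Finset.mul_sum]
  refine hasSum_sum fun t _ => ?_
  convert hasSum_ite_eq (delay A i t) (if i ∈ A t then g (delay A i t) * (T : ℝ)⁻¹ else 0) using 2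
    with τ
  split_ifs with h1 h2
  · rw [h1]
  · simp
  · simp

theorem lpValue_playFrequency (p : Fin n → ℕ+ → ℝ) (A : ℕ → Finset (Fin n)) (T : ℕ) :
    lpValue p (playFrequency A T) = totalPayoff p A T * (T : ℝ)⁻¹ := by
  simp only [lpValue, (hasSum_mul_playFrequency A T _ _).tsum_eq]
  rw [Finset.sum_comm, totalPayoff, Finset.sum_mul]
  refine Finset.sum_congr rfl fun t _ => ?_
  rw [Finset.sum_mul, Finset.sum_ite_mem, Finset.univ_inter]

theorem playFrequency_mem_lpFeasible {A : ℕ → Finset (Fin n)} (hA : ∀ t, (A t).card ≤ k) (T : ℕ) :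
    playFrequency A T ∈ lpFeasible n k := by
  have hs1 := fun i => by simpa using hasSum_mul_playFrequency A T i fun _ => 1
  have hs2 := fun i => hasSum_mul_playFrequency A T i fun τ => ((τ : ℕ) : ℝ)
  refine ⟨fun i τ => Finset.sum_nonneg fun t _ => by split_ifs <;> positivity,
    fun i => (hs1 i).summable, ?_, fun i => (hs2 i).summable, fun i => ?_⟩
  · simp only [(hs1 _).tsum_eq]
    have h : ∀ t, ∑ i, (if i ∈ A t then (T : ℝ)⁻¹ else 0) ≤ k * (T : ℝ)⁻¹ := fun t => by
      rw [Finset.sum_ite_mem, Finset.univ_inter, Finset.sum_const, nsmul_eq_mul]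
      exact mul_le_mul_of_nonneg_right (by exact_mod_cast hA t) (by positivity)
    rw [Finset.sum_comm]
    refine (Finset.sum_le_sum fun t _ => h t).trans ?_
    rw [Finset.sum_const, Nat.card_Icc, nsmul_eq_mul, Nat.add_sub_cancel, mul_left_comm]
    exact mul_le_of_le_one_right (Nat.cast_nonneg _) mul_inv_le_one
  · rw [(hs2 i).tsum_eq]
    have h := sum_delay_add_delay A i T
    have hle : (∑ t ∈ Finset.Icc 1 T, if i ∈ A t then (delay A i t : ℕ) else 0) ≤ T := by
      have := (delay A i (T + 1)).pos
      omega
    have heq : (∑ t ∈ Finset.Icc 1 T,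
        if i ∈ A t then ((delay A i t : ℕ) : ℝ) * (T : ℝ)⁻¹ else 0) =
        ((∑ t ∈ Finset.Icc 1 T, if i ∈ A t then (delay A i t : ℕ) else 0 : ℕ) : ℝ) * (T : ℝ)⁻¹ := by
      push_cast
      rw [Finset.sum_mul]
      exact Finset.sum_congr rfl fun t _ => by split_ifs <;> simp
    rw [heq]
    exact (mul_le_mul_of_nonneg_right (Nat.cast_le.2 hle) (by positivity)).trans mul_inv_le_one

theorem opt_le {p : Fin n → ℕ+ → ℝ} {L : ℝ} (hL : ∀ y ∈ lpFeasible n k, lpValue p y ≤ L) (T : ℕ) :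
    opt p k T ≤ L * T := by
  refine csSup_le ⟨_, fun _ => ∅, by simp, rfl⟩ ?_
  rintro _ ⟨A, hA, rfl⟩
  rcases Nat.eq_zero_or_pos T with rfl | hT
  · simp [totalPayoff]
  have h := hL _ (playFrequency_mem_lpFeasible hA T)
  rwa [lpValue_playFrequency, ← div_eq_mul_inv, div_le_iff₀ (by exact_mod_cast hT)] at h

theorem summable_mul_of_abs_le {x g : ℕ+ → ℝ} (hx0 : ∀ τ, 0 ≤ x τ) (hx : Summable x) {M : ℝ}
    (h : ∀ τ, |g τ| ≤ M) : Summable fun τ => g τ * x τ :=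
  Summable.of_norm_bounded (hx.mul_left M) fun τ => by
    rw [Real.norm_eq_abs, abs_mul, abs_of_nonneg (hx0 τ)]
    exact mul_le_mul_of_nonneg_right (h τ) (hx0 τ)

theorem lpValue_le_add {p q : Fin n → ℕ+ → ℝ} {M ε : ℝ} (hp : ∀ i τ, |p i τ| ≤ M)
    (hq : ∀ i τ, |q i τ| ≤ M) (hε : 0 ≤ ε) (hpq : ∀ i τ, p i τ ≤ q i τ + ε)
    {y : Fin n → ℕ+ → ℝ} (hy : y ∈ lpFeasible n k) :
    lpValue p y ≤ lpValue q y + k * ε := by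
  have hstep : lpValue p y ≤ ∑ i, ((∑' τ, q i τ * y i τ) + ε * ∑' τ, y i τ) := by
    refine Finset.sum_le_sum fun i _ => ?_
    have hsq := summable_mul_of_abs_le (hy.1 i) (hy.2.1 i) (hq i)
    rw [← tsum_mul_left, ← hsq.tsum_add ((hy.2.1 i).mul_left ε)]
    refine Summable.tsum_le_tsum (fun τ => ?_)
      (summable_mul_of_abs_le (hy.1 i) (hy.2.1 i) (hp i)) (hsq.add ((hy.2.1 i).mul_left ε))
    rw [← add_mul]
    exact mul_le_mul_of_nonneg_right (hpq i τ) (hy.1 i τ)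
  rw [Finset.sum_add_distrib, ← Finset.mul_sum] at hstep
  have := mul_le_mul_of_nonneg_left hy.2.2.1 hε
  rw [lpValue, lpValue] at *
  linarith

end RechargingBandits

end

theorem mainTheorem7 :
    ∃ C : ℝ, 0 < C ∧
      ∀ (n k : ℕ) (_hk : k < n)
        -- the true payoff functions
        (p : Fin n → ℕ+ → ℝ)
        (_hp : ∀ i τ, p i τ ∈ Set.Icc (0 : ℝ) 1)
        (_hmono : ∀ i, Monotone (p i))
        -- an upper bound on the recovery times
        (τmax : ℕ+)
        (_hrec : ∀ i τ, τmax ≤ τ → p i τ = p i τmax)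
        -- the estimates
        (ε : ℝ) (_hε : ε ∈ Set.Ioo (0 : ℝ) 1)
        (phat : Fin n → ℕ+ → ℝ)
        (_hphat : ∀ i τ, |phat i τ - p i τ| ≤ ε)
        -- the algorithm, run with the estimates
        (x : Fin n → ℕ+ → ℝ)
        (hx : RechargingBandits.IsOptimalExtremePoint phat k x)
        (A : (Fin n → RechargingBandits.ArmSeed) → ℕ → Finset (Fin n))
        (_hA : ∀ ω, RechargingBandits.IsOnlineRun phat k ω (A ω))
        (T : ℕ),
        RechargingBandits.gammaK k * RechargingBandits.opt p k T
            - C * ((k : ℝ) * ε * (T : ℝ) + (k : ℝ) * ((τmax : ℕ) : ℝ)) ≤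
          ∫ ω, RechargingBandits.totalPayoff p (A ω) T
            ∂(RechargingBandits.seedLaw x hx.feasible) := by
  open RechargingBandits in
  -- `2 k ε` is lost per round in the linear program and `2 k ε` in the online phase.
  refine ⟨4, by norm_num, ?_⟩
  intro n k _ p hp hmono τmax hrec ε hε phat hphat x hx A hA T
  have hε0 : 0 ≤ ε := hε.1.le
  have hp1 : ∀ i τ, |p i τ| ≤ 1 := fun i τ => by
    rw [abs_of_nonneg (hp i τ).1]; exact (hp i τ).2
  have hp2 : ∀ i τ, |p i τ| ≤ 2 := fun i τ => (hp1 i τ).trans one_le_two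
  have hq2 : ∀ i τ, |phat i τ| ≤ 2 := fun i τ => by
    have h1 := abs_le.1 (hphat i τ)
    have h2 := hp i τ
    have h3 := hε.2
    rw [abs_le]
    constructor <;> linarith [h2.1, h2.2, h1.1, h1.2]
  set L := lpValue p x with hLdef
  have hopt : opt p k T ≤ (L + 2 * k * ε) * T := by
    refine opt_le (fun y hy => ?_) T
    have h1 := lpValue_le_add hp2 hq2 hε0
      (fun i τ => by linarith [(abs_le.1 (hphat i τ)).1]) hy
    have h2 := lpValue_le_add hq2 hp2 hε0
      (fun i τ => by linarith [(abs_le.1 (hphat i τ)).2]) hx.feasible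
    linarith [hx.optimal y hy]
  have hLk : L ≤ k := by
    refine le_trans ?_ hx.feasible.2.2.1
    refine Finset.sum_le_sum fun i _ => Summable.tsum_le_tsum
      (fun τ => mul_le_of_le_one_left (hx.feasible.1 i τ) (hp i τ).2)
      (summable_mul_of_abs_le (hx.feasible.1 i) (hx.feasible.2.1 i) (hp1 i)) (hx.feasible.2.1 i)
  have hγ0 := gammaK_nonneg k
  have hγ1 := gammaK_le_one k
  have hL0 : 0 ≤ L := Finset.sum_nonneg fun i _ =>
    tsum_nonneg fun τ => mul_nonneg (hp i τ).1 (hx.feasible.1 i τ)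
  have hγL : gammaK k * L ≤ k := (mul_le_of_le_one_left hL0 hγ1).trans hLk
  have hkε : 0 ≤ (k : ℝ) * ε := by positivity
  have hround0 : ∀ ω t, 0 ≤ ∑ i ∈ A ω t, p i (delay (A ω) i t) := fun ω t =>
    Finset.sum_nonneg fun i _ => (hp i _).1
  have hint : ∀ t, Integrable (fun ω => ∑ i ∈ A ω t, p i (delay (A ω) i t))
      (seedLaw x hx.feasible) := fun t =>
    Integrable.of_bound (measurable_of_countable _).aestronglyMeasurable n (.of_forall fun ω => by
      rw [Real.norm_of_nonneg (hround0 ω t)]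
      refine (Finset.sum_le_sum fun i _ => (hp i _).2).trans ?_
      simpa using Finset.card_le_univ (A ω t))
  have hround : ∀ t, (gammaK k * L - 2 * k * ε) - (if t < (τmax : ℕ) then (k : ℝ) else 0) ≤
      ∫ ω, ∑ i ∈ A ω t, p i (delay (A ω) i t) ∂(seedLaw x hx.feasible) := by
    intro t
    split_ifs with ht
    · refine le_trans ?_ (integral_nonneg fun ω => hround0 ω t)
      linarith
    · rw [sub_zero]
      exact gammaK_mul_lpValue_le_integral_round hp hmono hrec hε0 hphat hx.feasible hA
        (not_lt.1 ht) (hint t)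
  have hearly : ∑ t ∈ Finset.Icc 1 T, (if t < (τmax : ℕ) then (k : ℝ) else 0) ≤
      k * ((τmax : ℕ) : ℝ) := by
    rw [← Finset.sum_filter, Finset.sum_const, nsmul_eq_mul, mul_comm]
    refine mul_le_mul_of_nonneg_left ?_ (Nat.cast_nonneg _)
    have hsub : (Finset.Icc 1 T).filter (· < (τmax : ℕ)) ⊆ Finset.range τmax := fun t ht => by
      simpa using (Finset.mem_filter.1 ht).2
    exact_mod_cast (Finset.card_le_card hsub).trans_eq (Finset.card_range _)
  have hsum := Finset.sum_le_sum fun t (_ : t ∈ Finset.Icc 1 T) => hround t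
  rw [Finset.sum_sub_distrib, Finset.sum_const, Nat.card_Icc, Nat.add_sub_cancel, nsmul_eq_mul,
    ← integral_finsetSum _ fun t _ => hint t] at hsum
  have hγopt := mul_le_mul_of_nonneg_left hopt hγ0
  have hγε : gammaK k * (k * ε * T) ≤ k * ε * T :=
    mul_le_of_le_one_left (by positivity) hγ1
  have hkτ : 0 ≤ (k : ℝ) * ((τmax : ℕ) : ℝ) := by positivity
  simp only [totalPayoff]
  linarith
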